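/- Let $P=(p_1,p_2,\ldots)$ be a sequence of prime numbers. The $P$-adic solenoid $\Sigma_P$ is the inverse limit of the sequence $S^1\leftarrow S^1\leftarrow S^1\leftarrow\cdots$ of unit circles in $\mathbb{C}$ whose $n$-th bonding map is $z\mapsto z^{p_n}$; that is, $\Sigma_P=\{(x_1,x_2,\ldots)\in (S^1)^{\mathbb N} : x_n=x_{n+1}^{p_n}\text{ for all } n\ge 1\}$ with the subspace topology of the product. For a positive integer $k$ let $h^k_P:\Sigma_P\to\Sigma_P$, $h^k_P(x_1,x_2,\ldots)=(x_1^k,x_2^k,\ldots)$, be the limit map induced by the $k$-th power maps of the circles. A $k$-fold covering of a space $Y$ is a continuous surjection $f:X\to Y$ such that every $y\in Y$ has an open neighborhood $W$ for which $f^{-1}(W)$ is the union of $k$ disjoint open subsets of $X$, each mapped homeomorphically onto $W$ by $f$. It is called connected if $X$ is a connected topological space. Two coverings $f_1:X_1\to Y$ and $f_2:X_2\to Y$ are equivalent if there is a homeomorphism $g:X_1\to X_2$ with $f_1=f_2\circ g$. Theorem. Let $k$ be a positive integer. If $k$ is divisible by some prime number that occurs infinitely often in $P$ (equals $p_n$ for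 infinitely many $n$), then there is no $k$-fold connected covering of $\Sigma_P$. Otherwise, the limit map $h^k_P$ is a $k$-fold connected covering of $\Sigma_P$ and, moreover, every $k$-fold connected covering of $\Sigma_P$ is equivalent to $h^k_P$. -/

import Mathlib

universe u

/-- The `P`-adic solenoid: the inverse limit of the sequence of unit circles
`S¹ ← S¹ ← S¹ ← ⋯` whose `n`-th bonding map is `z ↦ z ^ P n`, realised as a subspace of the
countable product of circles. -/
def Solenoid (P : ℕ → ℕ) : Set (ℕ → Circle) :=
  {x | ∀ n, x (n + 1) ^ P n = x n}

/-- The limit map of the solenoid induced by the `k`-th power map on each circle: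
`(x₀, x₁, …) ↦ (x₀ ^ k, x₁ ^ k, …)`. -/
noncomputable def solenoidPowMap (P : ℕ → ℕ) (k : ℕ) (x : Solenoid P) : Solenoid P :=
  ⟨fun n => (x : ℕ → Circle) n ^ k, fun n => by
    have h := x.2 n
    change ((x : ℕ → Circle) (n + 1) ^ k) ^ P n = (x : ℕ → Circle) n ^ k
    rw [← h, ← pow_mul, ← pow_mul, Nat.mul_comm]⟩

/-- A `k`-fold covering mapping: a continuous surjection such that every point of the base has an
open neighbourhood `W` with `f ⁻¹' W` homeomorphic over `W` to the disjoint union `W × Fin k` of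
`k` copies of `W`, that is, `f ⁻¹' W` is the union of `k` disjoint open sheets, each of which
is mapped homeomorphically onto `W` by `f`. -/
structure IsFoldCovering {X Y : Type*} [TopologicalSpace X] [TopologicalSpace Y]
    (k : ℕ) (f : X → Y) : Prop where
  continuous : Continuous f
  surjective : Function.Surjective f
  evenlyCovered : ∀ y : Y, IsEvenlyCovered f y (Fin k)

/-- A `k`-fold connected covering: a `k`-fold covering mapping from a connected space. -/
structure IsConnectedFoldCovering {X Y : Type*} [TopologicalSpace X] [TopologicalSpace Y]
    (k : ℕ) (f : X → Y) : Prop where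
  connected : ConnectedSpace X
  covering : IsFoldCovering k f

/-- Equivalence of mappings onto the same space: `f₁ = f₂ ∘ g` for some homeomorphism `g`. -/
def CoveringEquivalent {X₁ X₂ Y : Type*} [TopologicalSpace X₁] [TopologicalSpace X₂]
    (f₁ : X₁ → Y) (f₂ : X₂ → Y) : Prop :=
  ∃ g : X₁ ≃ₜ X₂, f₁ = f₂ ∘ g

/-- The number `p` occurs infinitely often in the sequence `P`. -/
def OccursInfinitelyOften (p : ℕ) (P : ℕ → ℕ) : Prop :=
  {n | P n = p}.Infinite

/-! The solenoid G carries a dense one-parameter subgroup `line`, and the kernels `fiber n` of its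
projections shrink to 1. For each n, G is the quotient of ℝ × `fiber n` by the infinite cyclic group
of returns of `line` to `fiber n`.

Translation along `line` lifts to a flow on any covering X. Over a small fiber, a k-fold X splits
into k sheets which the flow permutes after one period by a fixed σ; connectedness makes σ a
k-cycle. So X is the quotient of ℝ × `fiber m` by the subgroup of k-fold returns
(`exists_isQuotientMap`).

If k is coprime to all late primes, k-th powers are bijective on small fibers, and (t, κ) ↦ (kt, κ ^
k) induces a homeomorphism from G to X over the power map (`coveringEquivalent_pow`). If p divides k
and recurs in P, a coordinate raised to a suitable power descends to a nonconstant continuous map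
from X to the p-th roots of unity, contradicting connectedness (`not_isConnectedFoldCovering`). -/

open Topology Set Function

/-! ### Lifting flows -/

/-- The flow on a covering space of a topological group that lifts translation along a
one-parameter subgroup. -/
theorem IsCoveringMap.exists_flow {G X : Type*} [Group G] [TopologicalSpace G]
    [IsTopologicalGroup G] [TopologicalSpace X] {f : X → G} (hf : IsCoveringMap f)
    {e : ℝ → G} (he : Continuous e) (hadd : ∀ s t, e (s + t) = e s * e t) :
    ∃ Φ : ℝ → X → X, Continuous (uncurry Φ) ∧ (∀ t x, f (Φ t x) = e t * f x) ∧
      (∀ x, Φ 0 x = x) ∧ ∀ s t x, Φ (s + t) x = Φ s (Φ t x) := by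
  have he0 : e 0 = 1 := by simpa using hadd 0 0
  -- The homotopy parameter rescales time, and ℝ × X is the parameter space; the lift at parameter 1
  -- is then jointly continuous in time and point.
  let H : C(unitInterval × (ℝ × X), G) :=
    ⟨fun a => e (a.1 * a.2.1) * f a.2.2, by
      have := hf.continuous
      fun_prop⟩
  let i : C(ℝ × X, X) := ⟨Prod.snd, continuous_snd⟩
  have H0 : ∀ a, H (0, a) = f (i a) := fun a => by simp [H, i, he0]
  let Λ := hf.liftHomotopy H i H0
  have hΛ : ∀ a, f (Λ a) = H a := fun a => congr_fun (hf.liftHomotopy_lifts H i H0) a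
  have hΛ0 : ∀ a, Λ (0, a) = a.2 := hf.liftHomotopy_zero H i H0
  have hzero : ∀ x, Λ (1, (0, x)) = x := fun x => by
    have h := hf.eq_of_comp_eq (g₁ := fun s : unitInterval => Λ (s, (0, x))) (g₂ := fun _ => x)
      (by fun_prop) (by fun_prop) (by ext s; simp [hΛ, H, he0]) 0 (hΛ0 _)
    exact congr_fun h 1
  have hlift : ∀ t x, f (Λ (1, (t, x))) = e t * f x := fun t x => by simp [hΛ, H]
  refine ⟨fun t x => Λ (1, (t, x)), by unfold uncurry; fun_prop, hlift, hzero, fun s t x => ?_⟩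
  have h := hf.eq_of_comp_eq (g₁ := fun s : ℝ => Λ (1, (s + t, x)))
    (g₂ := fun s => Λ (1, (s, Λ (1, (t, x))))) (by fun_prop) (by fun_prop)
    (by ext s; simp [hlift, hadd, mul_assoc]) 0 (by simp [hzero])
  exact congr_fun h s

/-- A continuous map to a Hausdorff space that is onto already on a compact set is a quotient
map. -/
theorem Topology.IsQuotientMap.of_isCompact_image_eq_univ {A Y : Type*} [TopologicalSpace A]
    [TopologicalSpace Y] [T2Space Y] {g : A → Y} (hg : Continuous g) {C : Set A}
    (hC : IsCompact C) (hgC : g '' C = univ) : IsQuotientMap g := by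
  have : CompactSpace C := isCompact_iff_compactSpace.mp hC
  have hr : Continuous (fun c : C => g c) := by fun_prop
  have hs : Surjective (fun c : C => g c) := fun y => by
    obtain ⟨a, ha, rfl⟩ := hgC.symm ▸ mem_univ y
    exact ⟨⟨a, ha⟩, rfl⟩
  exact IsQuotientMap.of_comp continuous_subtype_val hg
    (hr.isClosedMap.isQuotientMap hr hs)

/-! ### Solenoidal systems -/

/-- A one-parameter subgroup of a topological group, together with a shrinking sequence of
closed subgroups which it meets in discrete subgroups, such that it generates the group together
with each of them. -/
structure SolenoidalSystem (G : Type*) [CommGroup G] [TopologicalSpace G] where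
  line : ℝ → G
  continuous_line : Continuous line
  line_add : ∀ s t, line (s + t) = line s * line t
  fiber : ℕ → Subgroup G
  isClosed_fiber : ∀ n, IsClosed (fiber n : Set G)
  fiber_anti : Antitone fiber
  exists_fiber_subset : ∀ U ∈ 𝓝 (1 : G), ∃ n, (fiber n : Set G) ⊆ U
  period : ℕ → ℕ
  period_pos : ∀ n, 0 < period n
  period_dvd : ∀ {m n}, m ≤ n → period m ∣ period n
  line_mem_fiber_iff : ∀ n t, line t ∈ fiber n ↔ ∃ j : ℤ, t = j * period n
  exists_line_mul : ∀ n x, ∃ t ∈ Icc 0 (period n : ℝ), ∃ κ ∈ fiber n, x = line t * κ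

namespace SolenoidalSystem

variable {G : Type*} [CommGroup G] [TopologicalSpace G] (S : SolenoidalSystem G)

theorem line_zero : S.line 0 = 1 := by simpa using S.line_add 0 0

theorem line_neg (t : ℝ) : S.line (-t) = (S.line t)⁻¹ := by
  rw [eq_inv_iff_mul_eq_one, ← S.line_add, neg_add_cancel, S.line_zero]

theorem line_sub (s t : ℝ) : S.line (s - t) = S.line s / S.line t := by
  rw [sub_eq_add_neg, S.line_add, S.line_neg, div_eq_mul_inv]

theorem line_int_mul_mem (n : ℕ) (j : ℤ) : S.line (j * S.period n) ∈ S.fiber n :=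
  (S.line_mem_fiber_iff n _).2 ⟨j, rfl⟩

theorem line_mul_mem_of_dvd {m n : ℕ} {d : ℤ} (h : n ≤ m) :
    S.line (d * S.period m) ∈ S.fiber n :=
  S.fiber_anti h (S.line_int_mul_mem m d)

theorem exists_sub_eq_of_line_mul_eq {n : ℕ} {s t : ℝ} {κ κ' : S.fiber n}
    (h : S.line s * κ = S.line t * κ') : ∃ j : ℤ, s - t = j * S.period n := by
  rw [← S.line_mem_fiber_iff, S.line_sub]
  have : S.line s / S.line t = κ' / κ := by
    rw [div_eq_div_iff_mul_eq_mul, h, mul_comm]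
  rw [this]
  exact div_mem κ'.2 κ.2

theorem isQuotientMap_line_mul [IsTopologicalGroup G] [CompactSpace G] [T2Space G] (n : ℕ) :
    IsQuotientMap (fun a : ℝ × S.fiber n => S.line a.1 * a.2) := by
  have := isCompact_iff_compactSpace.mp (S.isClosed_fiber n).isCompact
  refine .of_isCompact_image_eq_univ ?_ ((isCompact_Icc (a := 0) (b := (S.period n : ℝ))).prod
    isCompact_univ) (eq_univ_of_forall fun x => ?_)
  · have := S.continuous_line
    fun_prop
  · obtain ⟨t, ht, κ, hκ, rfl⟩ := S.exists_line_mul n x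
    exact ⟨(t, ⟨κ, hκ⟩), ⟨ht, trivial⟩, rfl⟩

/-- Uniform local constancy: compactness of the fiber gives one neighbourhood of 1 that works for
every κ, and it contains a smaller fiber. -/
theorem exists_forall_apply_mul_eq [IsTopologicalGroup G] [CompactSpace G] {D : Type*}
    [TopologicalSpace D] [DiscreteTopology D] {n : ℕ} {c : S.fiber n → D} (hc : Continuous c) :
    ∃ m, ∀ α : S.fiber n, (α : G) ∈ S.fiber m → ∀ κ, c (κ * α) = c κ := by
  have := isCompact_iff_compactSpace.mp (S.isClosed_fiber n).isCompact
  have h : ∀ᶠ α in 𝓝 (1 : S.fiber n), ∀ κ ∈ univ, c (κ * α) = c κ := by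
    refine isCompact_univ.eventually_forall_of_forall_eventually fun κ _ => ?_
    refine IsOpen.mem_nhds (s := {z : S.fiber n × S.fiber n | c (z.2 * z.1) = c z.2}) ?_ (by simp)
    exact isOpen_discrete {p : D × D | p.1 = p.2} |>.preimage
      (by fun_prop : Continuous fun z : S.fiber n × S.fiber n => (c (z.2 * z.1), c z.2))
  rw [nhds_subtype_eq_comap, Filter.eventually_comap] at h
  obtain ⟨m, hm⟩ := S.exists_fiber_subset _ h
  exact ⟨m, fun α hα κ => hm hα α rfl κ trivial⟩

end SolenoidalSystem

theorem IsFoldCovering.isCoveringMap {X Y : Type*} [TopologicalSpace X] [TopologicalSpace Y]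
    {k : ℕ} {f : X → Y} (hf : IsFoldCovering k f) : IsCoveringMap f :=
  fun y => (hf.evenlyCovered y).to_isEvenlyCovered_preimage

theorem IsFoldCovering.t2Space {X Y : Type*} [TopologicalSpace X] [TopologicalSpace Y] [T2Space Y]
    {k : ℕ} {f : X → Y} (hf : IsFoldCovering k f) : T2Space X := by
  refine ⟨fun x y hxy => ?_⟩
  by_cases h : f x = f y
  · exact hf.isCoveringMap.isSeparatedMap x y h hxy
  · exact separated_by_continuous hf.continuous h

theorem IsFoldCovering.exists_trivialization {X Y : Type*} [TopologicalSpace X]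
    [TopologicalSpace Y] {k : ℕ} [NeZero k] {f : X → Y} (hf : IsFoldCovering k f) (y : Y) :
    ∃ t : Bundle.Trivialization (Fin k) f, y ∈ t.baseSet :=
  ⟨(hf.evenlyCovered y).toTrivialization', (hf.evenlyCovered y).2.choose_spec.1⟩

/-! ### Structure of connected coverings -/

namespace SolenoidalSystem

variable {G : Type*} [CommGroup G] [TopologicalSpace G] (S : SolenoidalSystem G)

/-- Over a sufficiently small fiber, a `k`-fold covering splits into `k` sections which the lifted
flow permutes after one period. -/
theorem exists_permuted_sections [IsTopologicalGroup G] [CompactSpace G]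
    {X : Type*} [TopologicalSpace X] {k : ℕ} [NeZero k] {f : X → G} (hf : IsFoldCovering k f)
    {Φ : ℝ → X → X} (hΦ : Continuous (uncurry Φ)) (hfΦ : ∀ t x, f (Φ t x) = S.line t * f x)
    (hΦ0 : ∀ x, Φ 0 x = x) (hΦadd : ∀ s t x, Φ (s + t) x = Φ s (Φ t x)) (n₀ : ℕ) :
    ∃ m ≥ n₀, ∃ (σ : Equiv.Perm (Fin k)) (s : Fin k → S.fiber m → X) (l : X → Fin k),
      (∀ i, Continuous (s i)) ∧ (∀ i κ, f (s i κ) = κ) ∧ (∀ i κ, l (s i κ) = i) ∧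
      (∀ x (h : f x ∈ S.fiber m), s (l x) ⟨f x, h⟩ = x) ∧
      ∀ x, f x ∈ S.fiber m → l (Φ (S.period m) x) = σ (l x) := by
  obtain ⟨τ, hτ⟩ := hf.exists_trivialization 1
  obtain ⟨n₁, hn₁⟩ := S.exists_fiber_subset _ (τ.open_baseSet.mem_nhds hτ)
  set n := max n₀ n₁ with hn
  have hbase : ∀ κ ∈ S.fiber n, κ ∈ τ.baseSet := fun κ hκ =>
    hn₁ (S.fiber_anti (le_max_right _ _) hκ)
  let s : Fin k → S.fiber n → X := fun i κ => τ.invFun (κ, i)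
  let l : X → Fin k := fun x => (τ x).2
  have hs : ∀ i, Continuous (s i) := fun i =>
    τ.continuousOn_invFun.comp_continuous (by fun_prop)
      fun κ => τ.target_eq ▸ ⟨hbase κ κ.2, trivial⟩
  have hfs : ∀ i κ, f (s i κ) = κ := fun i κ => τ.proj_symm_apply' (hbase κ κ.2)
  have hls : ∀ i κ, l (s i κ) = i := fun i κ => by
    simpa [l, s] using congr_arg Prod.snd (τ.apply_symm_apply' (hbase κ κ.2) (x := i))
  have hsl : ∀ x (h : f x ∈ S.fiber n), s (l x) ⟨f x, h⟩ = x := fun x h =>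
    τ.symm_apply_mk_proj (τ.mem_source.mpr (hbase _ h))
  have hinj : ∀ {x y}, f x ∈ S.fiber n → f x = f y → l x = l y → x = y := by
    intro x y hx hxy hl
    have hy : f y ∈ S.fiber n := hxy ▸ hx
    rw [← hsl x hx, ← hsl y hy, hl]
    congr 1
    exact Subtype.ext hxy
  have hl : ContinuousOn l (f ⁻¹' τ.baseSet) := by
    rw [← τ.source_eq]
    exact continuous_snd.comp_continuousOn τ.continuousOn_toFun
  have hΦmem : ∀ (j : ℤ) {m : ℕ} x, n ≤ m → f x ∈ S.fiber n →
      f (Φ (j * S.period m) x) ∈ S.fiber n := fun j m x hm hx => by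
    rw [hfΦ]
    exact mul_mem (S.line_mul_mem_of_dvd hm) hx
  have hΦmem1 : ∀ x, f x ∈ S.fiber n → f (Φ (S.period n) x) ∈ S.fiber n := fun x hx => by
    simpa using hΦmem 1 x le_rfl hx
  -- The sheet reached after one period from sheet i over κ. It may vary with κ, but only through
  -- the class of κ modulo a smaller fiber `fiber m`.
  let c : S.fiber n → Fin k → Fin k := fun κ i => l (Φ (S.period n) (s i κ))
  have hc : Continuous c := by
    refine continuous_pi fun i => hl.comp_continuous ?_ fun κ => hbase _ (hΦmem1 _ ?_)
    · exact hΦ.comp ((continuous_const (y := (S.period n : ℝ))).prodMk (hs i))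
    · rw [hfs]; exact κ.2
  obtain ⟨m₁, hm₁⟩ := S.exists_forall_apply_mul_eq hc
  set m := max n m₁ with hm
  have hnm : n ≤ m := le_max_left _ _
  have step : ∀ x y, f x ∈ S.fiber n → f x / f y ∈ S.fiber m → l x = l y →
      l (Φ (S.period n) x) = l (Φ (S.period n) y) := by
    intro x y hx hxy hlxy
    have hd : f x / f y ∈ S.fiber n := S.fiber_anti hnm hxy
    have hy : f y ∈ S.fiber n := by
      have := div_mem hx hd
      simpa using this
    have h := congr_fun (hm₁ ⟨f x / f y, hd⟩ (S.fiber_anti (le_max_right _ _) hxy) ⟨f y, hy⟩) (l x)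
    have e : (⟨f y, hy⟩ * ⟨f x / f y, hd⟩ : S.fiber n) = ⟨f x, hx⟩ := Subtype.ext (by simp)
    rw [e] at h
    simp only [c] at h
    rwa [hsl, hlxy, hsl] at h
  have iter : ∀ (j : ℕ) x y, f x ∈ S.fiber n → f x / f y ∈ S.fiber m → l x = l y →
      l (Φ (j * S.period n) x) = l (Φ (j * S.period n) y) := by
    intro j
    induction j with
    | zero => intro x y _ _ h; simpa [hΦ0] using h
    | succ j ih =>
      intro x y hx hxy h
      have e : ((j + 1 : ℕ) : ℝ) * S.period n = S.period n + j * S.period n := by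
        push_cast; ring
      rw [e, hΦadd, hΦadd]
      refine step _ _ ?_ ?_ (ih x y hx hxy h)
      · simpa using hΦmem j x le_rfl hx
      · rw [hfΦ, hfΦ, mul_div_mul_left_eq_div]; exact hxy
  obtain ⟨d, hd⟩ := S.period_dvd hnm
  -- A period of level m is d periods of level n, and translation preserves the quotient f x / f y,
  -- so the one-period statement iterates.
  have key : ∀ x y, f x ∈ S.fiber m → f y ∈ S.fiber m → l x = l y →
      l (Φ (S.period m) x) = l (Φ (S.period m) y) := by
    intro x y hx hy h
    have := iter d x y (S.fiber_anti hnm hx) (div_mem hx hy) h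
    have e : (S.period m : ℝ) = d * S.period n := by rw [hd]; push_cast; ring
    rwa [e]
  have hf1 : ∀ i, f (s i 1) = 1 := fun i => hfs i 1
  let σ : Fin k → Fin k := fun i => l (Φ (S.period m) (s i 1))
  have hσ : Injective σ := fun i j hij => by
    have h1 : Φ (S.period m) (s i 1) = Φ (S.period m) (s j 1) := by
      refine hinj ?_ (by rw [hfΦ, hfΦ, hf1, hf1]) hij
      simpa using hΦmem 1 (s i 1) hnm (by rw [hf1]; exact one_mem _)
    have h2 := congr_arg (Φ (-S.period m)) h1
    rw [← hΦadd, ← hΦadd, neg_add_cancel, hΦ0, hΦ0] at h2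
    rw [← hls i 1, h2, hls]
  have hincl : ∀ κ : S.fiber m, (κ : G) ∈ S.fiber n := fun κ => S.fiber_anti hnm κ.2
  refine ⟨m, (le_max_left _ _).trans hnm, .ofBijective σ (Finite.injective_iff_bijective.mp hσ),
    fun i κ => s i ⟨κ, hincl κ⟩, l, fun i => (hs i).comp (by fun_prop), fun i κ => hfs _ _,
    fun i κ => hls _ _, fun x h => hsl x _, fun x hx => ?_⟩
  exact key x (s (l x) 1) hx (by rw [hf1]; exact one_mem _) (hls _ _).symm

/-- A connected `k`-fold covering is the quotient of the product of the line with a small fiber by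
the subgroup generated by the `k`-th power of the period. -/
theorem exists_isQuotientMap [IsTopologicalGroup G] [CompactSpace G] [T2Space G]
    {X : Type*} [TopologicalSpace X] {k : ℕ} (hk : 0 < k) {f : X → G}
    (hf : IsConnectedFoldCovering k f) (n₀ : ℕ) :
    ∃ m ≥ n₀, ∃ L : ℝ × S.fiber m → X, IsQuotientMap L ∧
      (∀ a, f (L a) = S.line a.1 * a.2) ∧
      ∀ a b, L a = L b ↔ S.line a.1 * a.2 = S.line b.1 * b.2 ∧
        ∃ j : ℤ, a.1 - b.1 = j * (k * S.period m) := by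
  have : NeZero k := ⟨hk.ne'⟩
  have := hf.connected
  have := hf.covering.t2Space
  obtain ⟨Φ, hΦ, hfΦ, hΦ0, hΦadd⟩ :=
    hf.covering.isCoveringMap.exists_flow S.continuous_line S.line_add
  obtain ⟨m, hm, σ, s, l, hs, hfs, hls, hsl, hσ⟩ :=
    S.exists_permuted_sections hf.covering hΦ hfΦ hΦ0 hΦadd n₀
  have hcomp := isCompact_iff_compactSpace.mp (S.isClosed_fiber m).isCompact
  have hfmem : ∀ i κ, f (s i κ) ∈ S.fiber m := fun i κ => by rw [hfs]; exact κ.2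
  have hΦmem : ∀ (j : ℤ) x, f x ∈ S.fiber m → f (Φ (j * S.period m) x) ∈ S.fiber m :=
    fun j x hx => by rw [hfΦ]; exact mul_mem (S.line_int_mul_mem m j) hx
  have hσn : ∀ (j : ℕ) x, f x ∈ S.fiber m → l (Φ (j * S.period m) x) = (σ ^ j) (l x) := by
    intro j
    induction j with
    | zero => intro x _; simp [hΦ0]
    | succ j ih =>
      intro x hx
      have e : ((j + 1 : ℕ) : ℝ) * S.period m = S.period m + j * S.period m := by
        push_cast; ring
      rw [e, hΦadd, hσ _ (by simpa using hΦmem j x hx), ih x hx, pow_succ']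
      rfl
  have hσz : ∀ (j : ℤ) x, f x ∈ S.fiber m → l (Φ (j * S.period m) x) = (σ ^ j) (l x) := by
    intro j x hx
    obtain ⟨n, rfl | rfl⟩ := j.eq_nat_or_neg
    · simpa using hσn n x hx
    · have h := hσn n _ (hΦmem (-n) x hx)
      rw [← hΦadd] at h
      have e : (n : ℝ) * S.period m + ((-n : ℤ) : ℝ) * S.period m = 0 := by push_cast; ring
      rw [e, hΦ0] at h
      rw [h, zpow_neg, zpow_natCast, ← Equiv.Perm.mul_apply, inv_mul_cancel, Equiv.Perm.one_apply]
  have hinj : ∀ x y, f x ∈ S.fiber m → f x = f y → l x = l y → x = y := by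
    intro x y hx hxy hl
    have hy : f y ∈ S.fiber m := hxy ▸ hx
    rw [← hsl x hx, ← hsl y hy, hl]
    congr 1
    exact Subtype.ext hxy
  have hΦinj : ∀ t, Injective (Φ t) := fun t x y h => by
    have := congr_arg (Φ (-t)) h
    rwa [← hΦadd, ← hΦadd, neg_add_cancel, hΦ0, hΦ0] at this
  let L : Fin k → ℝ × S.fiber m → X := fun i a => Φ a.1 (s i a.2)
  have hL : ∀ i, Continuous (L i) := fun i =>
    hΦ.comp (continuous_fst.prodMk ((hs i).comp continuous_snd))
  have hfL : ∀ i a, f (L i a) = S.line a.1 * a.2 := fun i a => by rw [hfΦ, hfs]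
  have hLeq : ∀ i i' a b, L i a = L i' b ↔ S.line a.1 * a.2 = S.line b.1 * b.2 ∧
      ∃ j : ℤ, a.1 - b.1 = j * S.period m ∧ (σ ^ j) i = i' := by
    rintro i i' ⟨t, κ⟩ ⟨u, κ'⟩
    have hsub : ∀ j : ℤ, t - u = j * S.period m → L i (t, κ) = Φ u (Φ (j * S.period m) (s i κ)) :=
      fun j hj => by rw [← hj, ← hΦadd]; simp [L]
    constructor
    · intro h
      have hbase : S.line t * κ = S.line u * κ' := by rw [← hfL i (t, κ), h, hfL]
      obtain ⟨j, hj⟩ := S.exists_sub_eq_of_line_mul_eq hbase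
      refine ⟨hbase, j, hj, ?_⟩
      rw [hsub j hj] at h
      rw [← hls i κ, ← hσz j _ (hfmem i κ), hΦinj _ h, hls]
    · rintro ⟨hbase, j, hj, rfl⟩
      rw [hsub j hj]
      refine congr_arg (Φ u) (hinj _ _ (hΦmem j _ (hfmem i κ)) ?_ ?_)
      · rw [hfΦ, hfs, hfs, ← hj, S.line_sub, div_mul_eq_mul_div]
        simp only at hbase
        rw [hbase, mul_div_cancel_left]
      · rw [hσz j _ (hfmem i κ), hls, hls]
  let C : Set (ℝ × S.fiber m) := Icc 0 (S.period m : ℝ) ×ˢ univ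
  have hC : IsCompact C := isCompact_Icc.prod isCompact_univ
  have hcover : ∀ x, ∃ i, ∃ a ∈ C, L i a = x := by
    intro x
    obtain ⟨t, ht, κ, hκ, hx⟩ := S.exists_line_mul m (f x)
    have h : f (Φ (-t) x) = κ := by rw [hfΦ, hx, S.line_neg, inv_mul_cancel_left]
    have h' : f (Φ (-t) x) ∈ S.fiber m := h ▸ hκ
    refine ⟨l (Φ (-t) x), (t, ⟨_, h'⟩), ⟨ht, trivial⟩, ?_⟩
    simp only [L]
    rw [hsl, ← hΦadd, add_neg_cancel, hΦ0]
  have hclosed : ∀ T : Set (Fin k), IsClosed (⋃ i ∈ T, L i '' C) := fun T =>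
    (toFinite T).isClosed_biUnion fun i _ => (hC.image (hL i)).isClosed
  -- The flow saturation of one σ-orbit of sheets is a finite union of compact sets, and so is its
  -- complement; being clopen and nonempty, it is all of X.
  have hcycle : ∀ i i', σ.SameCycle i i' := by
    intro i₀
    by_contra! hne
    obtain ⟨i₁, hi₁⟩ := hne
    let T : Set (Fin k) := {i | σ.SameCycle i₀ i}
    have hcompl : (⋃ i ∈ T, L i '' C)ᶜ = ⋃ i ∈ Tᶜ, L i '' C := by
      ext x
      simp only [mem_compl_iff, mem_iUnion, mem_image, exists_prop, not_exists, not_and]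
      constructor
      · intro h
        obtain ⟨i, a, ha, rfl⟩ := hcover x
        exact ⟨i, fun hi => h i hi a ha rfl, a, ha, rfl⟩
      · rintro ⟨i, hi, a, -, rfl⟩ i' hi' b - hb
        obtain ⟨-, j, -, hj⟩ := (hLeq i' i b a).1 hb
        exact hi (Equiv.Perm.SameCycle.trans hi' ⟨j, hj⟩)
    have hclopen : IsClopen (⋃ i ∈ T, L i '' C) :=
      ⟨hclosed T, isClosed_compl_iff.mp (hcompl ▸ hclosed Tᶜ)⟩
    have h0 : (0, 1) ∈ C := ⟨⟨le_rfl, Nat.cast_nonneg _⟩, trivial⟩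
    have huniv := hclopen.eq_univ ⟨L i₀ (0, 1), mem_biUnion (Equiv.Perm.SameCycle.refl _ _)
      (mem_image_of_mem _ h0)⟩
    have h1 : L i₁ (0, 1) ∈ (⋃ i ∈ T, L i '' C)ᶜ := by
      rw [hcompl]
      exact mem_biUnion (show i₁ ∈ Tᶜ from hi₁) (mem_image_of_mem _ h0)
    exact h1 (huniv ▸ mem_univ _)
  have hon : σ.IsCycleOn (Finset.univ : Finset (Fin k)) :=
    ⟨by simp, fun _ _ _ _ => hcycle _ _⟩
  refine ⟨m, hm, L 0, ?_, hfL 0, fun a b => ?_⟩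
  -- Passing from sheet i to sheet 0 costs fewer than k periods, hence the interval extends k
  -- periods to the left.
  · let C' : Set (ℝ × S.fiber m) := Icc (-(k * S.period m : ℝ)) (S.period m) ×ˢ univ
    refine .of_isCompact_image_eq_univ (hL 0) (C := C') (isCompact_Icc.prod isCompact_univ)
      (eq_univ_of_forall fun x => ?_)
    obtain ⟨i, ⟨t, κ⟩, ⟨ht, -⟩, rfl⟩ := hcover x
    obtain ⟨j, hjk, hj⟩ := hon.exists_pow_eq (Finset.mem_univ i) (Finset.mem_univ 0)
    have hjk : (j : ℝ) ≤ k := by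
      have : j < k := by simpa using hjk
      exact_mod_cast this.le
    have hp : (0 : ℝ) < S.period m := by exact_mod_cast S.period_pos m
    refine ⟨(t - j * S.period m, κ * ⟨_, S.line_int_mul_mem m j⟩), ⟨⟨?_, ?_⟩, trivial⟩, ?_⟩
    · have := mul_le_mul_of_nonneg_right hjk hp.le
      have := ht.1
      simp only; linarith
    · have : (0 : ℝ) ≤ j * S.period m := by positivity
      have := ht.2
      simp only at this ⊢; linarith
    · refine ((hLeq _ _ _ _).2 ⟨?_, j, ?_, by simpa using hj⟩).symm
      · simp only [Subgroup.coe_mul, S.line_sub, Int.cast_natCast]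
        rw [mul_comm (κ : G), ← mul_assoc, div_mul_cancel]
      · simp
  · rw [hLeq]
    refine and_congr_right fun _ => ⟨?_, ?_⟩
    · rintro ⟨j, hj, h0⟩
      rw [hon.zpow_apply_eq (Finset.mem_univ _), Finset.card_univ, Fintype.card_fin] at h0
      obtain ⟨c, rfl⟩ := h0
      exact ⟨c, by rw [hj]; push_cast; ring⟩
    · rintro ⟨c, hc⟩
      refine ⟨k * c, by rw [hc]; push_cast; ring, ?_⟩
      rw [hon.zpow_apply_eq (Finset.mem_univ _), Finset.card_univ, Fintype.card_fin]
      exact dvd_mul_right _ _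

end SolenoidalSystem

/-- Every x differs from a point of the line by an element of an arbitrarily small fiber. This gives
connectedness of G. -/
theorem SolenoidalSystem.denseRange_line {G : Type*} [CommGroup G] [TopologicalSpace G]
    [IsTopologicalGroup G] (S : SolenoidalSystem G) : DenseRange S.line := by
  intro x
  rw [mem_closure_iff_nhds]
  intro U hU
  have h : (fun κ => x * κ⁻¹) ⁻¹' U ∈ 𝓝 (1 : G) :=
    (by fun_prop : Continuous fun κ : G => x * κ⁻¹).continuousAt.preimage_mem_nhds
      (by simpa using hU)
  obtain ⟨n, hn⟩ := S.exists_fiber_subset _ h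
  obtain ⟨t, -, κ, hκ, rfl⟩ := S.exists_line_mul n x
  exact ⟨S.line t, by simpa using hn hκ, t, rfl⟩

/-! ### The solenoid as a solenoidal system -/

namespace Solenoid

/-- The solenoid as a subgroup of the product of circles. -/
def subgroup (P : ℕ → ℕ) : Subgroup (ℕ → Circle) where
  carrier := Solenoid P
  one_mem' := fun n => by simp
  mul_mem' := fun {x y} hx hy n => by
    rw [Pi.mul_apply, mul_pow, hx n, hy n, Pi.mul_apply]
  inv_mem' := fun {x} hx n => by rw [Pi.inv_apply, inv_pow, hx n, Pi.inv_apply]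

noncomputable instance (P : ℕ → ℕ) : CommGroup (Solenoid P) :=
  inferInstanceAs (CommGroup (subgroup P))

instance (P : ℕ → ℕ) : IsTopologicalGroup (Solenoid P) :=
  inferInstanceAs (IsTopologicalGroup (subgroup P))

instance (P : ℕ → ℕ) : CompactSpace (Solenoid P) := by
  rw [← isCompact_iff_compactSpace]
  refine IsClosed.isCompact ?_
  have : Solenoid P = ⋂ n, {x | x (n + 1) ^ P n = x n} := by ext; simp [Solenoid]
  rw [this]
  exact isClosed_iInter fun n => isClosed_eq (by fun_prop) (by fun_prop)

variable (P : ℕ → ℕ)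

/-- The projection of the solenoid to a circle. -/
def coord (n : ℕ) : Solenoid P →* Circle where
  toFun x := x.1 n
  map_one' := rfl
  map_mul' _ _ := rfl

variable {P}

theorem continuous_coord (n : ℕ) : Continuous (coord P n) :=
  (continuous_apply n).comp continuous_subtype_val

@[ext]
theorem ext_coord {x y : Solenoid P} (h : ∀ n, coord P n x = coord P n y) : x = y :=
  Subtype.ext (funext h)

theorem coord_succ_pow (x : Solenoid P) (n : ℕ) : coord P (n + 1) x ^ P n = coord P n x := x.2 n

theorem coord_pow_prod (x : Solenoid P) {m n : ℕ} (h : m ≤ n) :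
    coord P n x ^ ∏ i ∈ Finset.Ico m n, P i = coord P m x := by
  induction n, h using Nat.le_induction with
  | base => simp
  | succ n h ih => rw [Finset.prod_Ico_succ_top h, mul_comm, pow_mul, coord_succ_pow, ih]

theorem exists_pow_eq_of_pow_eq_one {H : Type*} [CommGroup H] {z : H} {k d : ℕ}
    (h : k.Coprime d) (hz : z ^ d = 1) : ∃ w : H, w ^ k = z ∧ w ^ d = 1 := by
  -- The Bézout coefficient inverts k modulo d.
  refine ⟨z ^ (k.gcdA d), ?_, ?_⟩
  · have hb := Nat.gcd_eq_gcd_ab k d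
    rw [h.gcd_eq_one] at hb
    rw [← zpow_natCast, ← zpow_mul, mul_comm, ← mul_one (z ^ _),
      ← one_zpow (k.gcdB d), ← hz, ← zpow_natCast, ← zpow_mul, ← zpow_add, ← hb]
    simp
  · rw [← zpow_natCast, zpow_comm, zpow_natCast, hz, one_zpow]

theorem eq_one_of_pow_eq_one {H : Type*} [CommGroup H] {z : H} {k d : ℕ}
    (h : k.Coprime d) (hk : z ^ k = 1) (hd : z ^ d = 1) : z = 1 := by
  rw [← orderOf_dvd_iff_pow_eq_one] at hk hd
  exact orderOf_eq_one_iff.mp (Nat.dvd_one.mp (h.gcd_eq_one ▸ Nat.dvd_gcd hk hd))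

theorem eq_one_of_coord_eq_one_of_pow_eq_one {k m : ℕ} (hk : ∀ j ≥ m, k.Coprime (P j))
    {x : Solenoid P} (hx : coord P m x = 1) (hxk : x ^ k = 1) : x = 1 := by
  ext1 n
  have hn : coord P n x ^ k = 1 := by rw [← map_pow, hxk, map_one]
  rcases le_total m n with h | h
  · refine eq_one_of_pow_eq_one (Nat.Coprime.prod_right fun j hj => ?_) hn
      ((coord_pow_prod x h).trans hx)
    exact hk j (Finset.mem_Ico.mp hj).1
  · rw [← coord_pow_prod x h, hx, one_pow, map_one]

/-- Coordinate n of x is a root of unity of order dividing a product coprime to k, so it has a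
unique k-th root killed by that product; uniqueness makes these roots compatible with the bonding
maps. -/
theorem exists_pow_eq_of_coord_eq_one {k m : ℕ} (hk : ∀ j ≥ m, k.Coprime (P j))
    {x : Solenoid P} (hx : coord P m x = 1) : ∃ y, coord P m y = 1 ∧ y ^ k = x := by
  have hcop : ∀ n, k.Coprime (∏ i ∈ Finset.Ico m n, P i) := fun n =>
    Nat.Coprime.prod_right fun j hj => hk j (Finset.mem_Ico.mp hj).1
  have hone : ∀ n, coord P n x ^ (∏ i ∈ Finset.Ico m n, P i) = 1 := fun n => by
    rcases le_total m n with h | h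
    · rw [coord_pow_prod x h, hx]
    · rw [← coord_pow_prod x h, hx, one_pow, one_pow]
  choose w hwk hwd using fun n => exists_pow_eq_of_pow_eq_one (hcop n) (hone n)
  have hw : w ∈ Solenoid P := fun n => by
    rw [← div_eq_one]
    refine eq_one_of_pow_eq_one (hcop n) ?_ ?_
    · rw [div_pow, ← pow_mul, mul_comm, pow_mul, hwk, hwk, coord_succ_pow, div_self']
    · rw [div_pow, hwd, div_one]
      rcases le_or_gt m n with h | h
      · rw [← pow_mul, mul_comm, ← Finset.prod_Ico_succ_top h, hwd]
      · have := hwd (n + 1)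
        rw [Finset.Ico_eq_empty (by omega), Finset.prod_empty, pow_one] at this
        rw [this, one_pow, one_pow]
  refine ⟨⟨w, hw⟩, ?_, ext_coord fun n => ?_⟩
  · change w m = 1
    simpa using hwd m
  · rw [map_pow]
    exact hwk n

/-- The one-parameter subgroup of the solenoid and the kernels of its projections. -/
noncomputable def system (hP : ∀ n, (P n).Prime) : SolenoidalSystem (Solenoid P) where
  line t := ⟨fun n => Circle.exp (2 * Real.pi * t / (∏ i ∈ Finset.range n, P i : ℕ)), fun n => by
    have h : ((∏ i ∈ Finset.range n, P i : ℕ) : ℝ) ≠ 0 := by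
      exact_mod_cast (Finset.prod_pos fun i _ => (hP i).pos).ne'
    have h' : (P n : ℝ) ≠ 0 := by exact_mod_cast (hP n).ne_zero
    rw [← Circle.exp_natCast_mul, Finset.prod_range_succ, Nat.cast_mul]
    congr 1
    field_simp⟩
  continuous_line := by
    refine Continuous.subtype_mk (continuous_pi fun n => Circle.exp.continuous.comp ?_) _
    fun_prop
  line_add s t := ext_coord fun n => by
    rw [map_mul]
    change Circle.exp _ = Circle.exp _ * Circle.exp _
    rw [← Circle.exp_add]
    congr 1
    ring
  fiber n := (coord P n).ker
  isClosed_fiber n := isClosed_singleton.preimage (continuous_coord n)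
  fiber_anti m n h x hx := by
    rw [MonoidHom.mem_ker] at hx ⊢
    rw [← coord_pow_prod x h, hx, one_pow]
  exists_fiber_subset U hU := by
    obtain ⟨V, hV, hVU⟩ := mem_nhds_subtype _ _ _ |>.mp hU
    rw [nhds_pi, Filter.mem_pi] at hV
    obtain ⟨I, hI, t, ht, hItV⟩ := hV
    obtain ⟨n, hn⟩ := hI.bddAbove
    refine ⟨n, fun x hx => hVU (hItV fun i hi => ?_)⟩
    have hx : coord P n x = 1 := hx
    have : coord P i x = 1 := by rw [← coord_pow_prod x (hn hi), hx, one_pow]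
    change coord P i x ∈ t i
    rw [this]
    exact mem_of_mem_nhds (ht i)
  period n := ∏ i ∈ Finset.range n, P i
  period_pos n := Finset.prod_pos fun i _ => (hP i).pos
  period_dvd h := Finset.prod_dvd_prod_of_subset _ _ _ (Finset.range_mono h)
  line_mem_fiber_iff n t := by
    have h : ((∏ i ∈ Finset.range n, P i : ℕ) : ℝ) ≠ 0 := by
      exact_mod_cast (Finset.prod_pos fun i _ => (hP i).pos).ne'
    rw [MonoidHom.mem_ker]
    change Circle.exp _ = 1 ↔ _
    rw [Circle.exp_eq_one]
    refine exists_congr fun j => ?_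
    rw [div_eq_iff h]
    have := Real.two_pi_pos.ne'
    constructor
    · intro h
      apply mul_left_cancel₀ this
      rw [h]; ring
    · rintro rfl
      ring
  exists_line_mul n x := by
    have h : (0 : ℝ) < (∏ i ∈ Finset.range n, P i : ℕ) := by
      exact_mod_cast Finset.prod_pos fun i _ => (hP i).pos
    have hπ := Real.two_pi_pos
    obtain ⟨r, hr⟩ := Circle.exp_surjective (coord P n x)
    obtain ⟨s, ⟨hs0, hs1⟩, hs⟩ := Circle.periodic_exp.exists_mem_Ico₀ hπ r
    refine ⟨s / (2 * Real.pi) * (∏ i ∈ Finset.range n, P i : ℕ), ⟨by positivity, ?_⟩,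
      _, ?_, (mul_div_cancel _ x).symm⟩
    · exact mul_le_of_le_one_left h.le ((div_le_one hπ).2 hs1.le)
    · rw [MonoidHom.mem_ker, map_div, div_eq_one, ← hr, hs]
      change _ = Circle.exp _
      congr 1
      field_simp

end Solenoid

/-! ### The power map as a covering -/

namespace SolenoidalSystem

variable {G : Type*} [CommGroup G] [TopologicalSpace G] (S : SolenoidalSystem G)

theorem line_natCast_mul (n : ℕ) (t : ℝ) : S.line (n * t) = S.line t ^ n := by
  induction n with
  | zero => simp [S.line_zero]
  | succ n ih =>
    have e : ((n + 1 : ℕ) : ℝ) * t = n * t + t := by push_cast; ring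
    rw [e, S.line_add, ih, pow_succ]

/-- If the `k`-th power map is bijective on a fiber, then it is onto with a kernel of `k` elements. -/
theorem surjective_pow_and_card_ker {k m : ℕ} (hk : 0 < k)
    (hinj : ∀ x ∈ S.fiber m, x ^ k = 1 → x = 1)
    (hsurj : ∀ x ∈ S.fiber m, ∃ y ∈ S.fiber m, y ^ k = x) :
    Surjective (fun x : G => x ^ k) ∧ Nat.card (powMonoidHom k : G →* G).ker = k := by
  have hk0 : (k : ℝ) ≠ 0 := by exact_mod_cast hk.ne'
  have hp0 : (S.period m : ℝ) ≠ 0 := by exact_mod_cast (S.period_pos m).ne'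
  have hline : ∀ t, S.line (t / k) ^ k = S.line t := fun t => by
    rw [← S.line_natCast_mul, mul_div_cancel₀ _ hk0]
  refine ⟨fun x => ?_, ?_⟩
  · obtain ⟨t, -, κ, hκ, rfl⟩ := S.exists_line_mul m x
    obtain ⟨y, -, rfl⟩ := hsurj κ hκ
    exact ⟨S.line (t / k) * y, by simp only [mul_pow, hline]⟩
  · obtain ⟨κ, hκ, hκk⟩ := hsurj (S.line (S.period m)) (by simpa using S.line_int_mul_mem m 1)
    -- Two k-th roots of `line (period m)`, one on the line and one in the fiber; their quotient
    -- generates the kernel.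
    set w := S.line (S.period m / k) / κ with hw
    have hwk : w ^ k = 1 := by rw [div_pow, hline, hκk, div_self']
    have hord : orderOf w = k := by
      refine Nat.dvd_antisymm (orderOf_dvd_of_pow_eq_one hwk) ?_
      have h : S.line (orderOf w * (S.period m / k)) ∈ S.fiber m := by
        have : S.line (orderOf w * (S.period m / k)) = w ^ orderOf w * κ ^ orderOf w := by
          rw [S.line_natCast_mul, ← mul_pow, div_mul_cancel]
        rw [this, pow_orderOf_eq_one, one_mul]
        exact pow_mem hκ _
      obtain ⟨j, hj⟩ := (S.line_mem_fiber_iff m _).1 h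
      rw [mul_div_assoc', div_eq_iff hk0, mul_right_comm, mul_left_inj' hp0] at hj
      have hj : (orderOf w : ℤ) = j * k := by exact_mod_cast hj
      exact Int.natCast_dvd_natCast.mp ⟨j, by rw [hj, mul_comm]⟩
    have hker : (powMonoidHom k : G →* G).ker = Subgroup.zpowers w := by
      refine le_antisymm (fun x hx => ?_) ?_
      · have hx : x ^ k = 1 := hx
        obtain ⟨t, -, α, hα, rfl⟩ := S.exists_line_mul m x
        have h : S.line (k * t) ∈ S.fiber m := by
          rw [mul_pow] at hx
          rw [S.line_natCast_mul, eq_inv_of_mul_eq_one_left hx]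
          exact inv_mem (pow_mem hα k)
        obtain ⟨j, hj⟩ := (S.line_mem_fiber_iff m _).1 h
        refine ⟨j, ?_⟩
        have ht : S.line t = S.line (S.period m / k) ^ j := by
          have e : t = j * (S.period m / k) := by field_simp; linarith
          obtain ⟨n, rfl | rfl⟩ := j.eq_nat_or_neg
          · rw [e, Int.cast_natCast, S.line_natCast_mul, zpow_natCast]
          · rw [e, Int.cast_neg, neg_mul, S.line_neg, Int.cast_natCast, S.line_natCast_mul,
              zpow_neg, zpow_natCast]
        -- Dividing by w ^ j moves a kernel element into the fiber, where injectivity makes it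
        -- trivial.
        have h1 : S.line t * α / w ^ j = α * κ ^ j := by
          rw [ht, hw, div_zpow, div_div_eq_mul_div, mul_assoc, mul_div_cancel_left]
        have h2 := hinj (S.line t * α / w ^ j) (h1 ▸ mul_mem hα (zpow_mem hκ j)) (by
          rw [div_pow, hx, ← zpow_natCast, zpow_comm, zpow_natCast, hwk, one_zpow, div_one])
        exact (div_eq_one.mp h2).symm
      · rw [Subgroup.zpowers_le]
        exact hwk
    rw [hker, Nat.card_zpowers, hord]

end SolenoidalSystem

/-- By compactness the map is a quotient homomorphism; its kernel is finite, hence discrete, and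
each point fiber is a torsor under it. -/
theorem isFoldCovering_pow {G : Type*} [CommGroup G] [TopologicalSpace G] [IsTopologicalGroup G]
    [CompactSpace G] [T2Space G] {k : ℕ} (hk : 0 < k) (hs : Surjective (fun x : G => x ^ k))
    (hc : Nat.card (powMonoidHom k : G →* G).ker = k) :
    IsFoldCovering k (fun x : G => x ^ k) := by
  have hcont : Continuous (fun x : G => x ^ k) := by fun_prop
  have hfin : Finite (powMonoidHom k : G →* G).ker := Nat.finite_of_card_ne_zero (by omega)
  have hq : IsQuotientMap (powMonoidHom k : G →* G) := hcont.isClosedMap.isQuotientMap hcont hs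
  have hcov := hq.isQuotientCoveringMap_of_isDiscrete_ker_monoidHom ⟨inferInstance⟩
  refine ⟨hcont, hs, fun y => ?_⟩
  obtain ⟨x, hx⟩ := hs y
  have hy := IsQuotientCoveringMap.isCoveringMap _ _ hcov y
  have := hy.1
  let e : (powMonoidHom k : G →* G) ⁻¹' {y} ≃ Fin k :=
    (hcov.fiberEquivGroup ⟨x, hx⟩).trans (Finite.equivFinOfCardEq hc)
  exact hy.of_fiber_homeomorph
    ⟨e, continuous_of_discreteTopology, continuous_of_discreteTopology⟩

/-! ### Uniqueness of the covering -/

namespace SolenoidalSystem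

variable {G : Type*} [CommGroup G] [TopologicalSpace G] (S : SolenoidalSystem G)

/-- If the `k`-th power map is bijective on all small fibers, then it is, up to equivalence, the
only connected `k`-fold covering. -/
theorem coveringEquivalent_pow [IsTopologicalGroup G] [CompactSpace G] [T2Space G] {k n : ℕ}
    (hk : 0 < k) (hinj : ∀ m ≥ n, ∀ x ∈ S.fiber m, x ^ k = 1 → x = 1)
    (hsurj : ∀ m ≥ n, ∀ x ∈ S.fiber m, ∃ y ∈ S.fiber m, y ^ k = x)
    {X : Type*} [TopologicalSpace X] {f : X → G} (hf : IsConnectedFoldCovering k f) :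
    CoveringEquivalent f (fun x : G => x ^ k) := by
  have hk0 : (k : ℝ) ≠ 0 := by exact_mod_cast hk.ne'
  have := hf.covering.t2Space
  obtain ⟨m, hm, L, hL, hfL, hLeq⟩ := S.exists_isQuotientMap hk hf n
  have hq := S.isQuotientMap_line_mul m
  set q : ℝ × S.fiber m → G := fun a => S.line a.1 * a.2 with hqdef
  -- Scaling time by k turns single returns in G into the k-fold returns that `L` identifies.
  let B : ℝ × S.fiber m → X := fun a => L (k * a.1, a.2 ^ k)
  have hB : Continuous B := hL.continuous.comp (by fun_prop)
  have hfB : ∀ a, f (B a) = q a ^ k := fun a => by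
    rw [hfL, S.line_natCast_mul, Subgroup.coe_pow, ← mul_pow]
  have hBq : ∀ a b, B a = B b ↔ q a = q b := by
    intro a b
    constructor
    · intro h
      have hpow : q a ^ k = q b ^ k := by rw [← hfB, h, hfB]
      obtain ⟨-, j, hj⟩ := (hLeq _ _).1 h
      have hj : a.1 - b.1 = j * S.period m := by
        apply mul_left_cancel₀ hk0
        linear_combination hj
      rw [← div_eq_one]
      refine hinj m hm _ ?_ (by rw [div_pow, hpow, div_self'])
      simp only [hqdef]
      rw [mul_div_mul_comm, ← S.line_sub, hj]
      exact mul_mem (S.line_int_mul_mem m j) (div_mem a.2.2 b.2.2)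
    · intro h
      obtain ⟨j, hj⟩ := S.exists_sub_eq_of_line_mul_eq h
      refine (hLeq _ _).2 ⟨?_, j, by linear_combination (k : ℝ) * hj⟩
      rw [← hfL, ← hfL]
      exact (hfB a).trans ((congr_arg (· ^ k) h).trans (hfB b).symm)
  let g : G → X := fun x => B (surjInv hq.surjective x)
  have hg : ∀ a, g (q a) = B a := fun a => (hBq _ _).2 (surjInv_eq hq.surjective (q a))
  have hgc : Continuous g := hq.continuous_iff.2 (hB.congr fun a => (hg a).symm)
  have hgb : Bijective g := by
    constructor
    · intro x y h
      obtain ⟨a, rfl⟩ := hq.surjective x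
      obtain ⟨b, rfl⟩ := hq.surjective y
      rwa [hg, hg, hBq] at h
    · intro x
      obtain ⟨⟨t, κ⟩, rfl⟩ := hL.surjective x
      obtain ⟨y, hy, hyk⟩ := hsurj m hm κ κ.2
      refine ⟨q (t / k, ⟨y, hy⟩), ?_⟩
      rw [hg]
      have e : (⟨y, hy⟩ ^ k : S.fiber m) = κ := Subtype.ext hyk
      simp only [B, e, mul_div_cancel₀ _ hk0]
  let h : G ≃ₜ X := Continuous.homeoOfEquivCompactToT2 (f := Equiv.ofBijective g hgb) hgc
  have hfg : ∀ x, f (h x) = x ^ k := fun x => by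
    obtain ⟨a, rfl⟩ := hq.surjective x
    change f (g (q a)) = _
    rw [hg, hfB]
  refine ⟨h.symm, funext fun x => ?_⟩
  rw [comp_apply, ← hfg, h.apply_symm_apply]

end SolenoidalSystem

theorem Circle.finite_pow_eq_one {p : ℕ} (hp : 0 < p) : {z : Circle | z ^ p = 1}.Finite := by
  refine ((Polynomial.nthRootsFinset p (1 : ℂ)).finite_toSet.preimage
    (f := ((↑) : Circle → ℂ)) Circle.coe_injective.injOn).subset
      fun (z : Circle) (hz : z ^ p = 1) => ?_
  exact (Polynomial.mem_nthRootsFinset hp _).2 (congr_arg Circle.coeHom hz)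

/-! ### Nonexistence, and the main theorem -/

namespace Solenoid

variable {P : ℕ → ℕ}

theorem not_isConnectedFoldCovering (hP : ∀ n, (P n).Prime) {k p : ℕ} (hk : 0 < k)
    (hp : p.Prime) (hinf : OccursInfinitelyOften p P) (hpk : p ∣ k) {X : Type*}
    [TopologicalSpace X] {f : X → Solenoid P} : ¬ IsConnectedFoldCovering k f := by
  intro hf
  have := hf.connected
  let S := system hP
  obtain ⟨m, -, L, hL, hfL, hLeq⟩ := S.exists_isQuotientMap hk hf 0
  obtain ⟨M, hM, hmM⟩ := hinf.exists_gt m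
  have hM : P M = p := hM
  obtain ⟨k, rfl⟩ := hpk
  set D := ∏ i ∈ Finset.Ico m M, P i with hD
  have hDper : D * S.period m = S.period M := by
    rw [mul_comm]
    exact Finset.prod_range_mul_prod_Ico _ hmM.le
  have hper : S.period (M + 1) = S.period M * p := by
    rw [← hM]
    exact Finset.prod_range_succ _ _
  have hDperR : (D : ℝ) * S.period m = S.period M := by exact_mod_cast hDper
  have hperR : (S.period (M + 1) : ℝ) = S.period M * p := by exact_mod_cast hper
  -- On `fiber m` the coordinate M + 1 is killed by D * p, so its D-th power is a p-th root of
  -- unity.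
  let u : ℝ × S.fiber m → Circle := fun a => coord P (M + 1) a.2 ^ D
  have hu : Continuous u :=
    ((continuous_coord (M + 1)).comp (continuous_subtype_val.comp continuous_snd)).pow D
  have huL : ∀ a b, L a = L b → u a = u b := by
    intro a b h
    obtain ⟨h1, j, hj⟩ := (hLeq a b).1 h
    have h2 : (b.2 : Solenoid P) = S.line (a.1 - b.1) * a.2 := by
      rw [S.line_sub, div_mul_eq_mul_div, h1, mul_div_cancel_left]
    have h3 : coord P (M + 1) (S.line (a.1 - b.1) ^ D) = 1 := by
      rw [← S.line_natCast_mul]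
      -- Here k is the cofactor of p in the number of sheets: D times j * (p * k) periods of level m
      -- is j * k periods of level M + 1.
      refine (S.line_mem_fiber_iff (M + 1) _).2 ⟨j * k, ?_⟩
      rw [hj, hperR, ← hDperR]
      push_cast
      ring
    simp only [u]
    rw [h2, ← map_pow, ← map_pow, mul_pow, map_mul, h3, one_mul]
  have hup : ∀ a, u a ^ p = 1 := fun a => by
    have h : coord P m a.2 = 1 := a.2.2
    rw [← pow_mul, ← hM, ← Finset.prod_Ico_succ_top hmM.le,
      coord_pow_prod _ (hmM.le.trans M.le_succ), h]
  let v : X → Circle := fun x => u (surjInv hL.surjective x)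
  have hv : ∀ a, v (L a) = u a := fun a => huL _ _ (surjInv_eq hL.surjective (L a))
  have hvc : Continuous v := hL.continuous_iff.2 (hu.congr fun a => (hv a).symm)
  have hfin : (range v).Finite := (Circle.finite_pow_eq_one hp.pos).subset (by
    rintro _ ⟨x, rfl⟩
    exact hup _)
  refine (isPreconnected_range hvc).infinite_of_nontrivial ?_ hfin
  -- If u were 1 here, `line (period M)` would lie in `fiber (M + 1)`, whose period is p times
  -- larger.
  let b : ℝ × S.fiber m := (0, ⟨S.line (S.period m), by simpa using S.line_int_mul_mem m 1⟩)
  refine ⟨v (L (0, 1)), ⟨_, rfl⟩, v (L b), ⟨_, rfl⟩, fun h => ?_⟩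
  rw [hv, hv] at h
  have h1 : u (0, 1) = 1 := by simp [u]
  have h2 : S.line (S.period M) ∈ S.fiber (M + 1) := by
    rw [← hDperR, S.line_natCast_mul]
    change coord P (M + 1) _ = 1
    rw [map_pow]
    exact h.symm.trans h1
  obtain ⟨j, hj⟩ := (S.line_mem_fiber_iff _ _).1 h2
  have hpos : (0 : ℝ) < S.period M := by exact_mod_cast S.period_pos M
  have hj' : (j * p : ℝ) = 1 := by
    apply mul_left_cancel₀ hpos.ne'
    rw [hperR] at hj
    linear_combination -hj
  have hj'' : j * p = 1 := by exact_mod_cast hj'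
  have := Int.natCast_dvd_natCast.mp (⟨j, by rw [mul_comm, hj'']; rfl⟩ : (p : ℤ) ∣ (1 : ℕ))
  exact hp.one_lt.ne' (Nat.dvd_one.mp this)

theorem exists_forall_coprime (hP : ∀ n, (P n).Prime) {k : ℕ} (hk : 0 < k)
    (h : ¬ ∃ p : ℕ, p.Prime ∧ OccursInfinitelyOften p P ∧ p ∣ k) :
    ∃ n, ∀ j ≥ n, k.Coprime (P j) := by
  have hfin : (⋃ p ∈ k.primeFactors, {n | P n = p}).Finite := by
    refine k.primeFactors.finite_toSet.biUnion fun p hp => ?_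
    by_contra hinf
    exact h ⟨p, Nat.prime_of_mem_primeFactors hp, hinf, Nat.dvd_of_mem_primeFactors hp⟩
  obtain ⟨n, hn⟩ := hfin.bddAbove
  refine ⟨n + 1, fun j hj => ((hP j).coprime_iff_not_dvd.2 fun hd => ?_).symm⟩
  have := hn (mem_biUnion (Nat.mem_primeFactors.2 ⟨hP j, hd, hk.ne'⟩) (rfl : P j = P j))
  omega

theorem solenoidPowMap_eq_pow (k : ℕ) : solenoidPowMap P k = fun x => x ^ k :=
  funext fun x => ext_coord fun n => (map_pow (coord P n) x k).symm

end Solenoid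

theorem theorem2 (P : ℕ → ℕ) (hP : ∀ n, (P n).Prime) (k : ℕ) (hk : 0 < k) :
    ((∃ p : ℕ, p.Prime ∧ OccursInfinitelyOften p P ∧ p ∣ k) →
      ¬ ∃ (X : Type u) (_ : TopologicalSpace X) (f : X → Solenoid P),
        IsConnectedFoldCovering k f) ∧
    ((¬ ∃ p : ℕ, p.Prime ∧ OccursInfinitelyOften p P ∧ p ∣ k) →
      IsConnectedFoldCovering k (solenoidPowMap P k) ∧
      ∀ (X : Type u) [TopologicalSpace X] (f : X → Solenoid P),
        IsConnectedFoldCovering k f → CoveringEquivalent f (solenoidPowMap P k)) := by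
  refine ⟨?_, fun h => ?_⟩
  · rintro ⟨p, hp, hinf, hpk⟩ ⟨X, _, f, hf⟩
    exact Solenoid.not_isConnectedFoldCovering hP hk hp hinf hpk hf
  · let S := Solenoid.system hP
    obtain ⟨n, hn⟩ := Solenoid.exists_forall_coprime hP hk h
    have hinj : ∀ m ≥ n, ∀ x ∈ S.fiber m, x ^ k = 1 → x = 1 := fun m hm x hx =>
      Solenoid.eq_one_of_coord_eq_one_of_pow_eq_one (fun j hj => hn j (hm.trans hj)) hx
    have hsurj : ∀ m ≥ n, ∀ x ∈ S.fiber m, ∃ y ∈ S.fiber m, y ^ k = x := fun m hm x hx =>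
      Solenoid.exists_pow_eq_of_coord_eq_one (fun j hj => hn j (hm.trans hj)) hx
    rw [Solenoid.solenoidPowMap_eq_pow]
    refine ⟨⟨?_, ?_⟩, fun X _ f hf => S.coveringEquivalent_pow hk hinj hsurj hf⟩
    · exact { S.denseRange_line.preconnectedSpace S.continuous_line with
        toNonempty := ⟨1⟩ }
    · obtain ⟨hs, hc⟩ := S.surjective_pow_and_card_ker hk (hinj n le_rfl) (hsurj n le_rfl)
      exact isFoldCovering_pow hk hs hc
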